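/- Let $n\ge 1$, let $\mathbb F$ be a field with $2\neq 0$ in $\mathbb F$, and let $q\in\mathbb F^\times$. For $k\ge 0$ put $[k]=q+q^3+\dots+q^{2k-1}$ and, for $k>0$, $[-k]=-(q^{-1}+q^{-3}+\dots+q^{-(2k-1)})$. Assume that $[1],\dots,[n]$ are non-zero and that $-1,[1],\dots,[n]$ have square roots in $\mathbb F$, and fix a choice of these square roots. Let $\mathscr H_n$ be the Iwahori--Hecke algebra of $\mathfrak S_n$: the unital associative $\mathbb F$-algebra with generators $T_1,\dots,T_{n-1}$ and relations $(T_i-q)(T_i+q^{-1})=0$, $T_iT_j=T_jT_i$ for $|i-j|>1$, and $T_iT_{i+1}T_i=T_{i+1}T_iT_{i+1}$. For $w\in\mathfrak S_n$ of Coxeter length $\ell(w)$ put $T_w=T_{i_1}\cdots T_{i_k}$, where $w=s_{i_1}\cdots s_{i_k}$ is a reduced expression in the transpositions $s_i=(i,i+1)$. Let $\#$ be the $\mathbb F$-algebra automorphism of $\mathscr H_n$ with $T_i^\#=-T_i^{-1}$ (so $T_w^\#=(-1)^{\ell(w)}T_{w^{-1}}^{-1}$ for all $w$), let $\mathscr A_n=\{a\in\mathscr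 H_n : a^\#=a\}$ be the alternating Hecke algebra, and for $w\in\mathfrak S_n$ let $A_w=\tfrac12\bigl(T_w+(-1)^{\ell(w)}T_w^\#\bigr)$; if $w$ lies in the alternating group $\mathfrak A_n$ then $A_w\in\mathscr A_n$. For a partition $\lambda$ of $n$ let $S(\lambda)$ be the Specht module in seminormal form: the right $\mathscr H_n$-module with basis $v_{\mathfrak t}$, for $\mathfrak t$ a standard $\lambda$-tableau, and action \[ v_{\mathfrak t}T_i=\frac{-1}{[\rho]}\,v_{\mathfrak t}+\alpha_{\mathfrak t}(i)\,v_{\mathfrak t s_i},\qquad 1\le i<n, \] where $\rho=c_{\mathfrak t}(i)-c_{\mathfrak t}(i+1)$, $c_{\mathfrak t}(k)$ is the content (column minus row) of $k$ in $\mathfrak t$, $\mathfrak t s_i$ is $\mathfrak t$ with $i$ and $i+1$ exchanged, and $\alpha_{\mathfrak t}(i)=\alpha_\rho$ if $\mathfrak t s_i$ is standard and $\alpha_{\mathfrak t}(i)=0$ (the second term being omitted) otherwise; here $\alpha_k=\sqrt{-1}\sqrt{[k+1]}\sqrt{[k-1]}/[k]$ and $\alpha_{-k}=-\alpha_k$ for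 $k>0$. Let $\chi^\lambda$ be the character of $S(\lambda)$, let $\chi^\lambda_{\mathscr A}$ be the character of the restriction of $S(\lambda)$ to $\mathscr A_n$, and let $\lambda'$ be the partition conjugate to $\lambda$. Then, for every partition $\lambda$ of $n$ and every $w\in\mathfrak A_n$, \[ \chi^\lambda_{\mathscr A}(A_w)=\tfrac12\bigl(\chi^\lambda(T_w)+\chi^{\lambda'}(T_w)\bigr). \] -/

import Mathlib

noncomputable section

namespace AltHecke

/-! ### The symmetric group: Coxeter generators, reduced words, length

The symmetric group of degree `n` is `Equiv.Perm (Fin n)`; the numbers `1, …, n` are shifted to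
`0, …, n - 1`, so the generator with index `i : Fin (n - 1)` exchanges `i` and `i + 1`. -/

/-- The point `i` of `Fin n` attached to a generator index. -/
def lo {n : ℕ} (i : Fin (n - 1)) : Fin n := ⟨i.1, by omega⟩

/-- The point `i + 1` of `Fin n` attached to a generator index. -/
def hi {n : ℕ} (i : Fin (n - 1)) : Fin n := ⟨i.1 + 1, by omega⟩

/-- The Coxeter generator `s_i = (i, i+1)`. -/
def s {n : ℕ} (i : Fin (n - 1)) : Equiv.Perm (Fin n) := Equiv.swap (lo i) (hi i)

/-- The product `s_{i₁} ⋯ s_{iₖ}` of a word. -/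
def wordPerm {n : ℕ} (l : List (Fin (n - 1))) : Equiv.Perm (Fin n) := (l.map s).prod

theorem exists_word {n : ℕ} (w : Equiv.Perm (Fin n)) : ∃ l, wordPerm l = w := by
  rcases n with _ | m
  · exact ⟨[], Subsingleton.elim _ _⟩
  · have hw : w ∈ Submonoid.closure
        (Set.range fun i : Fin m ↦ Equiv.swap i.castSucc i.succ) := by
      rw [Equiv.Perm.mclosure_swap_castSucc_succ]; trivial
    obtain ⟨l, hl, rfl⟩ := Submonoid.exists_list_of_mem_closure hw
    clear hw
    induction l with
    | nil => exact ⟨[], rfl⟩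
    | cons a l ih =>
      obtain ⟨l', hl'⟩ := ih fun y hy ↦ hl y (List.mem_cons_of_mem _ hy)
      obtain ⟨i, hi⟩ := hl a List.mem_cons_self
      refine ⟨i :: l', ?_⟩
      rw [List.prod_cons, ← hl', ← hi]
      rfl

/-- The Coxeter length: the least length of a word in the generators with product `w`. -/
def length {n : ℕ} (w : Equiv.Perm (Fin n)) : ℕ :=
  sInf {k | ∃ l : List (Fin (n - 1)), wordPerm l = w ∧ l.length = k}

/-- `l` is a reduced expression for `w`. -/
def IsReducedWord {n : ℕ} (l : List (Fin (n - 1))) (w : Equiv.Perm (Fin n)) : Prop :=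
  wordPerm l = w ∧ l.length = length w

theorem exists_reducedWord {n : ℕ} (w : Equiv.Perm (Fin n)) : ∃ l, IsReducedWord l w := by
  obtain ⟨l, hl⟩ := exists_word w
  exact Nat.sInf_mem (s := {k | ∃ l : List (Fin (n - 1)), wordPerm l = w ∧ l.length = k})
    ⟨_, l, hl, rfl⟩

/-- A reduced expression for `w`. -/
def reducedWord {n : ℕ} (w : Equiv.Perm (Fin n)) : List (Fin (n - 1)) :=
  (exists_reducedWord w).choose

/-! ### The Iwahori--Hecke algebra -/

section Hecke

variable {R : Type*} [CommRing R] (q : Rˣ) (n : ℕ)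

/-- The defining relations of the Iwahori--Hecke algebra of type `A`. -/
inductive HeckeRel : FreeAlgebra R (Fin (n - 1)) → FreeAlgebra R (Fin (n - 1)) → Prop
  | quadratic (i : Fin (n - 1)) :
      HeckeRel
        ((FreeAlgebra.ι R i - algebraMap R _ (q : R)) *
          (FreeAlgebra.ι R i + algebraMap R _ ((q⁻¹ : Rˣ) : R))) 0
  | commute (i j : Fin (n - 1)) (h : i.1 + 1 < j.1) :
      HeckeRel (FreeAlgebra.ι R i * FreeAlgebra.ι R j) (FreeAlgebra.ι R j * FreeAlgebra.ι R i)
  | braid (i j : Fin (n - 1)) (h : i.1 + 1 = j.1) :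
      HeckeRel (FreeAlgebra.ι R i * FreeAlgebra.ι R j * FreeAlgebra.ι R i)
        (FreeAlgebra.ι R j * FreeAlgebra.ι R i * FreeAlgebra.ι R j)

/-- The Iwahori--Hecke algebra of the symmetric group of degree `n` with parameter `q`. -/
def Hecke : Type _ := RingQuot (HeckeRel q n)

instance : Ring (Hecke q n) := inferInstanceAs (Ring (RingQuot (HeckeRel q n)))

instance : Algebra R (Hecke q n) := inferInstanceAs (Algebra R (RingQuot (HeckeRel q n)))

/-- The quotient map from the free algebra. -/
def mk : FreeAlgebra R (Fin (n - 1)) →ₐ[R] Hecke q n := RingQuot.mkAlgHom R (HeckeRel q n)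

variable {n}

/-- The generator `T_i`. -/
def gen (i : Fin (n - 1)) : Hecke q n := mk q n (FreeAlgebra.ι R i)

theorem mk_rel {x y : FreeAlgebra R (Fin (n - 1))} (h : HeckeRel q n x y) : mk q n x = mk q n y :=
  RingQuot.mkAlgHom_rel R h

/-- The element `T_{i₁} ⋯ T_{iₖ}` of a word. -/
def wordT (l : List (Fin (n - 1))) : Hecke q n := (l.map (gen q)).prod

/-- The standard basis element `T_w`, the product of the generators along a reduced expression of
`w` (it does not depend on which one). -/
def T (w : Equiv.Perm (Fin n)) : Hecke q n := wordT q (reducedWord w)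

theorem gen_quadratic (i : Fin (n - 1)) :
    (gen q i - algebraMap R _ (q : R)) * (gen q i + algebraMap R _ ((q⁻¹ : Rˣ) : R)) = 0 := by
  simpa [gen] using mk_rel q (HeckeRel.quadratic (q := q) i)

theorem gen_commute (i j : Fin (n - 1)) (h : i.1 + 1 < j.1) :
    gen q i * gen q j = gen q j * gen q i := by
  simpa [gen] using mk_rel q (HeckeRel.commute (q := q) i j h)

theorem gen_braid (i j : Fin (n - 1)) (h : i.1 + 1 = j.1) :
    gen q i * gen q j * gen q i = gen q j * gen q i * gen q j := by
  simpa [gen] using mk_rel q (HeckeRel.braid (q := q) i j h)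

/-- The universal property of the presentation. -/
def lift {B : Type*} [Ring B] [Algebra R B] (f : Fin (n - 1) → B)
    (hquad : ∀ i, (f i - algebraMap R B (q : R)) * (f i + algebraMap R B ((q⁻¹ : Rˣ) : R)) = 0)
    (hcomm : ∀ i j : Fin (n - 1), i.1 + 1 < j.1 → f i * f j = f j * f i)
    (hbraid : ∀ i j : Fin (n - 1), i.1 + 1 = j.1 → f i * f j * f i = f j * f i * f j) :
    Hecke q n →ₐ[R] B :=
  RingQuot.liftAlgHom R ⟨FreeAlgebra.lift R f, by
    intro x y h
    cases h with
    | quadratic i => simpa using hquad i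
    | commute i j h => simpa using hcomm i j h
    | braid i j h => simpa using hbraid i j h⟩

theorem lift_gen {B : Type*} [Ring B] [Algebra R B] (f : Fin (n - 1) → B)
    (hquad : ∀ i, (f i - algebraMap R B (q : R)) * (f i + algebraMap R B ((q⁻¹ : Rˣ) : R)) = 0)
    (hcomm : ∀ i j : Fin (n - 1), i.1 + 1 < j.1 → f i * f j = f j * f i)
    (hbraid : ∀ i j : Fin (n - 1), i.1 + 1 = j.1 → f i * f j * f i = f j * f i * f j)
    (i : Fin (n - 1)) : lift q f hquad hcomm hbraid (gen q i) = f i := by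
  have h := RingQuot.liftAlgHom_mkAlgHom_apply (S := R) (s := HeckeRel q n) (FreeAlgebra.lift R f)
    (by
      intro x y h
      cases h with
      | quadratic i => simpa using hquad i
      | commute i j h => simpa using hcomm i j h
      | braid i j h => simpa using hbraid i j h) (FreeAlgebra.ι R i)
  rw [FreeAlgebra.lift_ι_apply] at h
  exact h

theorem algHom_ext_gen {B : Type*} [Ring B] [Algebra R B] {f g : Hecke q n →ₐ[R] B}
    (h : ∀ i, f (gen q i) = g (gen q i)) : f = g := by
  apply RingQuot.ringQuot_ext' R f g
  apply FreeAlgebra.hom_ext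
  funext i
  exact h i

theorem gen_sq (i : Fin (n - 1)) :
    gen q i * gen q i = ((q : R) - ((q⁻¹ : Rˣ) : R)) • gen q i + 1 := by
  have h := gen_quadratic q i
  rw [sub_mul, mul_add, mul_add, ← map_mul, Units.mul_inv, map_one, ← Algebra.commutes,
    ← Algebra.smul_def, ← Algebra.smul_def] at h
  rw [sub_smul, ← sub_eq_zero, ← h]
  abel

/-- The element `-T_i + q - q⁻¹`, which is `-T_i⁻¹`. -/
def hashGen (i : Fin (n - 1)) : Hecke q n :=
  ((q : R) - ((q⁻¹ : Rˣ) : R)) • 1 - gen q i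

theorem hashGen_mul_gen (i : Fin (n - 1)) : hashGen q i * gen q i = -1 := by
  rw [hashGen, sub_mul, gen_sq, smul_mul_assoc, one_mul]; abel

theorem gen_mul_hashGen (i : Fin (n - 1)) : gen q i * hashGen q i = -1 := by
  rw [hashGen, mul_sub, gen_sq, mul_smul_comm, mul_one]; abel

theorem hash_braid_aux {A : Type*} [Ring A] [Algebra R A] (h : R) (a b : A)
    (ha : a * a = h • a + 1) (hb : b * b = h • b + 1) (hab : a * b * a = b * a * b) :
    (h • 1 - a) * (h • 1 - b) * (h • 1 - a) = (h • 1 - b) * (h • 1 - a) * (h • 1 - b) := by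
  simp only [sub_mul, mul_sub, smul_mul_assoc, mul_smul_comm, one_mul, mul_one, ha, hb, hab,
    smul_sub, smul_add]
  module

/-- The algebra endomorphism underlying `#`. -/
def hashHom : Hecke q n →ₐ[R] Hecke q n :=
  lift q (hashGen q)
    (by
      intro i
      have h := gen_quadratic q i
      have h' : (gen q i + algebraMap R _ ((q⁻¹ : Rˣ) : R)) * (gen q i - algebraMap R _ (q : R))
          = 0 := by
        rw [← h]
        have c1 := Algebra.commutes (q : R) (gen q i)
        have c2 := Algebra.commutes ((q⁻¹ : Rˣ) : R) (gen q i)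
        have c3 := Algebra.commutes (A := Hecke q n) (q : R)
          (algebraMap R _ ((q⁻¹ : Rˣ) : R))
        simp only [sub_mul, mul_sub, add_mul, mul_add, c1, c2, c3]
        abel
      rw [← h', hashGen, ← Algebra.algebraMap_eq_smul_one, map_sub]
      rw [show algebraMap R (Hecke q n) (q : R) - algebraMap R _ ((q⁻¹ : Rˣ) : R) - gen q i
          - algebraMap R _ (q : R) = -(gen q i + algebraMap R _ ((q⁻¹ : Rˣ) : R)) by abel,
        show algebraMap R (Hecke q n) (q : R) - algebraMap R _ ((q⁻¹ : Rˣ) : R) - gen q i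
          + algebraMap R _ ((q⁻¹ : Rˣ) : R) = -(gen q i - algebraMap R _ (q : R)) by abel,
        neg_mul_neg])
    (by
      intro i j h
      have := gen_commute q i j h
      simp only [hashGen, sub_mul, mul_sub, smul_mul_assoc, mul_smul_comm, one_mul, mul_one, this]
      module)
    (by
      intro i j h
      exact hash_braid_aux _ _ _ (gen_sq q i) (gen_sq q j) (gen_braid q i j h))

theorem hashHom_gen (i : Fin (n - 1)) : hashHom q (gen q i) = hashGen q i :=
  lift_gen q _ _ _ _ i

theorem hashHom_hashHom (x : Hecke q n) : hashHom q (hashHom q x) = x := by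
  have : (hashHom q (n := n)).comp (hashHom q) = AlgHom.id R _ := by
    apply algHom_ext_gen
    intro i
    simp [hashHom_gen, hashGen]
  exact congrArg (fun f ↦ f x) this

/-- The automorphism `#` of the Hecke algebra, given on generators by `T_i ↦ -T_i⁻¹`; so
`T_x ↦ (-1)^{ℓ(x)} (T_{x⁻¹})⁻¹` for every `x`, see `hash_wordT`. -/
def hash : Hecke q n ≃ₐ[R] Hecke q n :=
  AlgEquiv.ofAlgHom (hashHom q) (hashHom q)
    (AlgHom.ext (hashHom_hashHom q)) (AlgHom.ext (hashHom_hashHom q))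

theorem hash_hash (x : Hecke q n) : hash q (hash q x) = x := hashHom_hashHom q x

theorem hash_gen (i : Fin (n - 1)) : hash q (gen q i) = hashGen q i := hashHom_gen q i

/-- `(T_{i₁} ⋯ T_{iₖ})^# = (-1)^k (T_{iₖ} ⋯ T_{i₁})⁻¹`. -/
theorem hash_wordT (l : List (Fin (n - 1))) :
    hash q (wordT q l) * wordT q l.reverse = (-1) ^ l.length ∧
      wordT q l.reverse * hash q (wordT q l) = (-1) ^ l.length := by
  induction l with
  | nil => simp [wordT]
  | cons i l ih =>
    have e1 : wordT q (i :: l) = gen q i * wordT q l := by simp [wordT]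
    have e2 : wordT q (i :: l).reverse = wordT q l.reverse * gen q i := by simp [wordT]
    have hc : ∀ (k : ℕ) (x : Hecke q n), (-1) ^ k * x = x * (-1) ^ k := fun k x ↦
      ((Commute.neg_one_left x).pow_left k).eq
    rw [e1, e2, map_mul, hash_gen, List.length_cons]
    constructor
    · calc hashGen q i * hash q (wordT q l) * (wordT q l.reverse * gen q i)
          = hashGen q i * ((hash q (wordT q l) * wordT q l.reverse) * gen q i) := by
            simp only [mul_assoc]
        _ = (-1) ^ (l.length + 1) := by
            rw [ih.1, hc, ← mul_assoc, hashGen_mul_gen, pow_succ, ← hc, mul_neg_one]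
    · calc wordT q l.reverse * gen q i * (hashGen q i * hash q (wordT q l))
          = wordT q l.reverse * (gen q i * hashGen q i) * hash q (wordT q l) := by
            simp only [mul_assoc]
        _ = (-1) ^ (l.length + 1) := by
            rw [gen_mul_hashGen, mul_neg_one, neg_mul, ih.2, pow_succ, mul_neg_one]

variable (n) in
/-- The alternating Hecke algebra: the fixed-point subalgebra of `#`. -/
def Alt : Subalgebra R (Hecke q n) := AlgHom.equalizer (hash q).toAlgHom (AlgHom.id R _)

end Hecke

/-! ### The elements `A_w` -/

section AElements

variable {F : Type*} [Field F] (q : Fˣ) {n : ℕ}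

/-- `A_w = ½ (T_w + ε_w T_w^#)`, with `ε_w = (-1)^{ℓ(w)}`. -/
def A (w : Equiv.Perm (Fin n)) : Hecke q n :=
  (2⁻¹ : F) • (T q w + (-1 : F) ^ length w • hash q (T q w))

theorem sign_wordPerm (l : List (Fin (n - 1))) :
    Equiv.Perm.sign (wordPerm l) = (-1) ^ l.length := by
  induction l with
  | nil => simp [wordPerm]
  | cons i l ih =>
    have e : wordPerm (i :: l) = s i * wordPerm l := by simp [wordPerm]
    have hne : lo i ≠ hi i := by simp [lo, hi, Fin.ext_iff]
    rw [e, map_mul, ih, s, Equiv.Perm.sign_swap hne, List.length_cons, pow_succ, mul_comm]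

theorem even_length {w : Equiv.Perm (Fin n)} (hw : w ∈ alternatingGroup (Fin n)) :
    Even (length w) := by
  obtain ⟨l, rfl, hl⟩ := exists_reducedWord w
  rw [Equiv.Perm.mem_alternatingGroup, sign_wordPerm] at hw
  rw [← hl]
  by_contra h
  rw [Nat.not_even_iff_odd] at h
  rw [h.neg_one_pow] at hw
  exact absurd hw (by decide)

theorem A_mem_Alt {w : Equiv.Perm (Fin n)} (hw : w ∈ alternatingGroup (Fin n)) :
    A q w ∈ Alt q n := by
  change hash q (A q w) = A q w
  rw [A, (even_length hw).neg_one_pow, one_smul, map_smul, map_add, hash_hash, add_comm]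

/-- For an even permutation `w`, the element `A_w` of the alternating Hecke algebra. -/
def altA (w : alternatingGroup (Fin n)) : Alt q n := ⟨A q w.1, A_mem_Alt q w.2⟩

end AElements

/-! ### Right modules and characters

A right module over an `F`-algebra `B` on a vector space `V` is an algebra homomorphism
`B → End(V)ᵒᵖ`. -/

section Characters

variable {F : Type*} [Field F] {B : Type*} [Ring B] [Algebra F B]
  {V : Type*} [AddCommGroup V] [Module F V]

/-- The character of a right module. -/
def character (M : B →ₐ[F] (Module.End F V)ᵐᵒᵖ) (b : B) : F :=
  LinearMap.trace F V (M b).unop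

/-- Restriction of a right module to a subalgebra. -/
def res (C : Subalgebra F B) (M : B →ₐ[F] (Module.End F V)ᵐᵒᵖ) : C →ₐ[F] (Module.End F V)ᵐᵒᵖ :=
  M.comp C.val

end Characters

/-! ### `q`-integers and square roots -/

section QInt

variable {F : Type*} [Field F]

/-- The `q`-integer: `[k] = q + q³ + ⋯ + q^{2k-1}` for `k ≥ 0` and
`[-k] = -(q⁻¹ + q⁻³ + ⋯ + q^{-(2k-1)})` for `k > 0`. -/
def qInt (q : Fˣ) : ℤ → F
  | Int.ofNat k => ∑ j ∈ Finset.range k, (q : F) ^ (2 * j + 1)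
  | Int.negSucc k => -∑ j ∈ Finset.range (k + 1), ((q⁻¹ : Fˣ) : F) ^ (2 * j + 1)

/-- The standing assumption on the field: `[1], …, [n]` are non-zero, and `-1, [1], …, [n]` have
square roots, a choice of which is fixed. (The value `sqrtQ k` is irrelevant unless
`1 ≤ k ≤ n`.) -/
structure SquareRoots (q : Fˣ) (n : ℕ) where
  /-- `√-1` -/
  sqrtNegOne : F
  /-- `√[k]` -/
  sqrtQ : ℕ → F
  sqrtNegOne_sq : sqrtNegOne ^ 2 = -1
  sqrtQ_sq : ∀ k : ℕ, 1 ≤ k → k ≤ n → sqrtQ k ^ 2 = qInt q k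
  qInt_ne_zero : ∀ k : ℕ, 1 ≤ k → k ≤ n → qInt q k ≠ 0

/-- `α_k = √-1 √[k+1] √[k-1] / [k]` for `k > 0`, and `α_{-k} = -α_k`. It is only used for
`2 ≤ |k| < n`. -/
def alpha {q : Fˣ} {n : ℕ} (D : SquareRoots q n) : ℤ → F
  | Int.ofNat k => D.sqrtNegOne * D.sqrtQ (k + 1) * D.sqrtQ (k - 1) / qInt q k
  | Int.negSucc k =>
      -(D.sqrtNegOne * D.sqrtQ (k + 1 + 1) * D.sqrtQ (k + 1 - 1) / qInt q (k + 1 : ℕ))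

end QInt

/-! ### Standard tableaux -/

section Tableaux

variable {μ : YoungDiagram} {n : ℕ}

/-- A bijective tableau `t` is standard if its entries increase along rows and down columns. -/
def IsStandard (t : μ.cells ≃ Fin n) : Prop :=
  ∀ x y : μ.cells, x ≠ y → x.1.1 ≤ y.1.1 → x.1.2 ≤ y.1.2 → t x < t y

variable (μ n) in
/-- The set of standard `μ`-tableaux with entries in `Fin n`. -/
structure Std : Type where
  /-- the underlying bijection -/
  tab : μ.cells ≃ Fin n
  isStandard : IsStandard tab

/-- The content (column minus row) of the entry `k` in `t`. -/
def content (t : μ.cells ≃ Fin n) (k : Fin n) : ℤ :=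
  ((t.symm k).1.2 : ℤ) - ((t.symm k).1.1 : ℤ)

/-- The axial distance from `i` to `i + 1` in `t`. -/
def axial (t : μ.cells ≃ Fin n) (i : Fin (n - 1)) : ℤ :=
  content t (lo i) - content t (hi i)

/-- The tableau `t s_i`, obtained from `t` by exchanging the entries `i` and `i + 1`. -/
def act (t : μ.cells ≃ Fin n) (i : Fin (n - 1)) : μ.cells ≃ Fin n := t.trans (s i)

/-! Combinatorial facts behind the seminormal action. -/

theorem act_apply (t : μ.cells ≃ Fin n) (i : Fin (n - 1)) (x : μ.cells) :
    act t i x = s i (t x) := rfl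

theorem act_act (t : μ.cells ≃ Fin n) (i : Fin (n - 1)) : act (act t i) i = t := by
  ext x
  simp [act, s]

theorem content_act (t : μ.cells ≃ Fin n) (i : Fin (n - 1)) (k : Fin n) :
    content (act t i) k = content t (s i k) := by
  simp [content, act, s]

theorem axial_act (t : μ.cells ≃ Fin n) (i : Fin (n - 1)) : axial (act t i) i = -axial t i := by
  simp [axial, content_act, s]

theorem IsStandard.le_of_le {t : μ.cells ≃ Fin n} (ht : IsStandard t) {x y : μ.cells}
    (h1 : x.1.1 ≤ y.1.1) (h2 : x.1.2 ≤ y.1.2) : (t x).1 ≤ (t y).1 := by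
  by_cases h : x = y
  · rw [h]
  · exact (ht x y h h1 h2).le

theorem IsStandard.lt_of {t : μ.cells ≃ Fin n} (ht : IsStandard t) {x y : μ.cells}
    (h1 : x.1.1 ≤ y.1.1) (h2 : x.1.2 ≤ y.1.2) (h3 : x.1.1 < y.1.1 ∨ x.1.2 < y.1.2) :
    (t x).1 < (t y).1 := by
  refine ht x y ?_ h1 h2
  rintro rfl
  omega

/-- Two distinct entries on one diagonal differ by at least three. -/
theorem IsStandard.content_ne {t : μ.cells ≃ Fin n} (ht : IsStandard t) {k l : Fin n}
    (hkl : k.1 < l.1) (hlk : l.1 ≤ k.1 + 2) : content t k ≠ content t l := by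
  intro h
  obtain ⟨x, rfl⟩ := t.surjective k
  obtain ⟨y, rfl⟩ := t.surjective l
  obtain ⟨⟨r, c⟩, hx⟩ := x
  obtain ⟨⟨r', c'⟩, hy⟩ := y
  simp only [content, Equiv.symm_apply_apply] at h
  have hr : r < r' := by
    by_contra hr
    have := ht.le_of_le (x := ⟨(r', c'), hy⟩) (y := ⟨(r, c), hx⟩) (by simp; omega) (by simp; omega)
    omega
  have m1 : (r + 1, c) ∈ μ.cells :=
    (μ.mem_cells _).2 (μ.up_left_mem (by omega) (by omega) ((μ.mem_cells _).1 hy))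
  have m2 : (r, c + 1) ∈ μ.cells :=
    (μ.mem_cells _).2 (μ.up_left_mem (by omega) (by omega) ((μ.mem_cells _).1 hy))
  have a1 := ht.lt_of (x := ⟨(r, c), hx⟩) (y := ⟨_, m1⟩) (by simp) (by simp) (by simp)
  have a2 := ht.lt_of (x := ⟨(r, c), hx⟩) (y := ⟨_, m2⟩) (by simp) (by simp) (by simp)
  have a3 := ht.lt_of (x := ⟨_, m1⟩) (y := ⟨(r', c'), hy⟩) (by simp; omega) (by simp; omega)
    (by simp; omega)
  have a4 := ht.lt_of (x := ⟨_, m2⟩) (y := ⟨(r', c'), hy⟩) (by simp; omega) (by simp; omega)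
    (by simp; omega)
  have ne : (t ⟨_, m1⟩).1 ≠ (t ⟨_, m2⟩).1 := by
    intro h
    have := t.injective (Fin.ext h)
    simp at this
  omega

theorem axial_ne_zero {t : μ.cells ≃ Fin n} (ht : IsStandard t) (i : Fin (n - 1)) :
    axial t i ≠ 0 := by
  rw [axial, sub_ne_zero]
  exact ht.content_ne (by simp [lo, hi]) (by simp [lo, hi])

theorem content_sub_lt (t : μ.cells ≃ Fin n) (k l : Fin n) : content t k - content t l < n := by
  obtain ⟨x, rfl⟩ := t.surjective k
  obtain ⟨y, rfl⟩ := t.surjective l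
  obtain ⟨⟨r, c⟩, hx⟩ := x
  obtain ⟨⟨r', c'⟩, hy⟩ := y
  simp only [content, Equiv.symm_apply_apply]
  have hmem : ∀ m : Fin (c + r' + 1),
      (if m.1 ≤ c then (0, m.1) else (m.1 - c, 0) : ℕ × ℕ) ∈ μ.cells := by
    intro m
    rw [μ.mem_cells]
    split_ifs with h
    · exact μ.up_left_mem (Nat.zero_le _) h ((μ.mem_cells _).1 hx)
    · exact μ.up_left_mem (by omega) (Nat.zero_le _) ((μ.mem_cells _).1 hy)
  have hinj : Function.Injective (fun m ↦ t ⟨_, hmem m⟩) := by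
    intro m m' h
    have h' := t.injective h
    simp only [Subtype.mk.injEq] at h'
    ext
    split_ifs at h' <;> simp only [Prod.mk.injEq] at h' <;> omega
  have := Fintype.card_le_of_injective _ hinj
  simp only [Fintype.card_fin] at this
  omega

theorem s_apply_val (i : Fin (n - 1)) (k : Fin n) :
    (s i k).1 = if k.1 = i.1 then i.1 + 1 else if k.1 = i.1 + 1 then i.1 else k.1 := by
  simp only [s, Equiv.swap_apply_def, Fin.ext_iff, lo, hi]
  split_ifs <;> simp_all

/-- Exchanging `i` and `i + 1` in a standard tableau gives a standard tableau exactly if the axial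
distance is not `±1`. -/
theorem isStandard_act_iff {t : μ.cells ≃ Fin n} (ht : IsStandard t) (i : Fin (n - 1)) :
    IsStandard (act t i) ↔ axial t i ≠ 1 ∧ axial t i ≠ -1 := by
  obtain ⟨x, hx⟩ := t.surjective (lo i)
  obtain ⟨y, hy⟩ := t.surjective (hi i)
  have hax : axial t i = ((x.1.2 : ℤ) - x.1.1) - ((y.1.2 : ℤ) - y.1.1) := by
    simp [axial, content, ← hx, ← hy]
  have hxv : (t x).1 = i.1 := by rw [hx]; rfl
  have hyv : (t y).1 = i.1 + 1 := by rw [hy]; rfl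
  constructor
  · intro hs
    have key : ¬ (x.1.1 ≤ y.1.1 ∧ x.1.2 ≤ y.1.2) := by
      rintro ⟨h1, h2⟩
      have := hs.le_of_le h1 h2
      rw [act_apply, act_apply, s_apply_val, s_apply_val, hxv, hyv] at this
      simp at this
    have key2 : ¬ (y.1.1 ≤ x.1.1 ∧ y.1.2 ≤ x.1.2) := by
      rintro ⟨h1, h2⟩
      have := ht.le_of_le h1 h2
      omega
    omega
  · rintro ⟨h1, h2⟩ a b hab hr hc
    have hlt : (t a).1 < (t b).1 := ht a b hab hr hc
    rw [Fin.lt_def, act_apply, act_apply, s_apply_val, s_apply_val]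
    by_cases hcase : (t a).1 = i.1 ∧ (t b).1 = i.1 + 1
    · exfalso
      obtain rfl : a = x := t.injective (Fin.ext (by omega))
      obtain rfl : b = y := t.injective (Fin.ext (by omega))
      have hne : ¬ (a.1.1 = b.1.1 ∧ a.1.2 = b.1.2) := fun h ↦
        hab (Subtype.ext (Prod.ext h.1 h.2))
      -- a cell strictly between the two
      obtain ⟨z, z1, z2, z3, z4, z5, z6⟩ : ∃ z : μ.cells, a.1.1 ≤ z.1.1 ∧ a.1.2 ≤ z.1.2 ∧
          z.1.1 ≤ b.1.1 ∧ z.1.2 ≤ b.1.2 ∧ (a.1.1 < z.1.1 ∨ a.1.2 < z.1.2) ∧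
          (z.1.1 < b.1.1 ∨ z.1.2 < b.1.2) := by
        have hb : (b.1.1, b.1.2) ∈ μ := (μ.mem_cells _).1 b.2
        by_cases h : a.1.1 < b.1.1
        · refine ⟨⟨(a.1.1 + 1, a.1.2), (μ.mem_cells _).2 (μ.up_left_mem h hc hb)⟩, ?_⟩
          simp only
          omega
        · refine ⟨⟨(a.1.1, a.1.2 + 1), (μ.mem_cells _).2
            (μ.up_left_mem hr (by omega) hb)⟩, ?_⟩
          simp only
          omega
      have c1 := ht.lt_of z1 z2 z5
      have c2 := ht.lt_of z3 z4 z6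
      omega
    · split_ifs <;> omega

end Tableaux

/-! ### The Specht modules in seminormal form -/

section Specht

variable {F : Type*} [Field F] {q : Fˣ} {n : ℕ}

/-- The vector space `S(μ)` with basis `v_t = Finsupp.single t 1`, for `t` a standard
`μ`-tableau. -/
abbrev SpechtSpace (F : Type*) [Field F] (μ : YoungDiagram) (n : ℕ) : Type _ := Std μ n →₀ F

open Classical in
/-- The operator `v_t ↦ -1/[ρ_t(i)] v_t + α_t(i) v_{t s_i}`, where `α_t(i)` is `α_{ρ_t(i)}` if
`t s_i` is standard and the second term is absent otherwise. -/
def spechtOp (D : SquareRoots q n) (μ : YoungDiagram) (i : Fin (n - 1)) :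
    Module.End F (SpechtSpace F μ n) :=
  Finsupp.linearCombination F fun t : Std μ n ↦
    (-1 / qInt q (axial t.tab i)) • Finsupp.single t (1 : F) +
      if h : IsStandard (act t.tab i) then
        alpha D (axial t.tab i) • Finsupp.single (⟨act t.tab i, h⟩ : Std μ n) (1 : F)
      else 0

/-! The relations of the Hecke algebra hold for these operators. -/

theorem qInt_succ (q : Fˣ) (k : ℤ) : qInt q (k + 1) = qInt q k + ((q ^ (2 * k + 1) : Fˣ) : F) := by
  rcases k with k | k
  · have : (Int.ofNat k + 1 : ℤ) = Int.ofNat (k + 1) := rfl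
    rw [this, qInt, qInt, Finset.sum_range_succ]
    rw [show (2 * Int.ofNat k + 1 : ℤ) = ((2 * k + 1 : ℕ) : ℤ) by simp, zpow_natCast]
    simp
  · rw [show (2 * Int.negSucc k + 1 : ℤ) = -((2 * k + 1 : ℕ) : ℤ) by
      rw [Int.negSucc_eq]; push_cast; ring, zpow_neg, zpow_natCast]
    rcases k with k | k
    · simp [qInt]
    · have : (Int.negSucc (k + 1) + 1 : ℤ) = Int.negSucc k := rfl
      rw [this, qInt, qInt, Finset.sum_range_succ _ (k + 1)]
      simp

theorem qInt_zero (q : Fˣ) : qInt q 0 = 0 := by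
  change qInt q (Int.ofNat 0) = 0
  simp [qInt]

theorem qInt_mul (q : Fˣ) (k : ℤ) :
    1 + ((q : F) - (q : F)⁻¹) * qInt q k = ((q ^ (2 * k) : Fˣ) : F) := by
  have hq : (q : F) ≠ 0 := q.ne_zero
  have step : ∀ k : ℤ, ((q : F) - (q : F)⁻¹) * ((q ^ (2 * k + 1) : Fˣ) : F) =
      ((q ^ (2 * (k + 1)) : Fˣ) : F) - ((q ^ (2 * k) : Fˣ) : F) := by
    intro k
    rw [mul_add, zpow_add, zpow_add]
    push_cast
    field_simp
  induction k using Int.induction_on with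
  | zero => simp [qInt_zero]
  | succ k ih =>
    rw [qInt_succ, mul_add, step, ← ih]; ring
  | pred k ih =>
    have h1 := qInt_succ q (-(k : ℤ) - 1)
    have h2 := step (-(k : ℤ) - 1)
    rw [sub_add_cancel] at h1 h2
    rw [h1, mul_add, h2] at ih
    linear_combination ih

theorem qInt_add (q : Fˣ) (x y : ℤ) :
    qInt q (x + y) = qInt q x + ((q ^ (2 * x) : Fˣ) : F) * qInt q y := by
  induction y using Int.induction_on with
  | zero => simp [qInt_zero]
  | succ k ih =>
    rw [← add_assoc, qInt_succ, ih, qInt_succ, mul_add (((q ^ (2 * x) : Fˣ) : F)),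
      show 2 * (x + (k : ℤ)) + 1 = 2 * x + (2 * k + 1) by ring, zpow_add]
    push_cast; ring
  | pred k ih =>
    have h1 := qInt_succ q (-(k : ℤ) - 1)
    have h2 := qInt_succ q (x + (-(k : ℤ) - 1))
    rw [sub_add_cancel] at h1
    rw [show x + (-(k : ℤ) - 1) + 1 = x + -k by ring,
      show 2 * (x + (-(k : ℤ) - 1)) + 1 = 2 * x + (2 * (-k - 1) + 1) by ring, zpow_add,
      ih, h1] at h2
    push_cast at h2 ⊢
    linear_combination -h2

theorem qInt_neg (q : Fˣ) (x : ℤ) :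
    qInt q (-x) = -qInt q x / (1 + ((q : F) - (q : F)⁻¹) * qInt q x) := by
  have h := qInt_add q x (-x)
  rw [add_neg_cancel, qInt_zero] at h
  have hu : ((q ^ (2 * x) : Fˣ) : F) ≠ 0 := Units.ne_zero _
  rw [qInt_mul, eq_div_iff hu]
  linear_combination -h

theorem SquareRoots.qInt_ne (D : SquareRoots q n) {x : ℤ} (hx : x ≠ 0) (h1 : x < n) (h2 : -x < n) :
    qInt q x ≠ 0 := by
  have pos : ∀ m : ℤ, 0 < m → m < n → qInt q m ≠ 0 := by
    intro m hm hmn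
    obtain ⟨k, rfl⟩ := Int.eq_ofNat_of_zero_le hm.le
    exact D.qInt_ne_zero k (by omega) (by omega)
  rcases lt_or_gt_of_ne hx with h | h
  · have hp := pos (-x) (by omega) h2
    intro h0
    apply hp
    rw [qInt_neg, h0]
    simp
  · exact pos x h h1

/-- `α_k` with value zero for `k = ±1`. -/
def alpha0 (D : SquareRoots q n) (k : ℤ) : F := if k = 1 ∨ k = -1 then 0 else alpha D k

theorem alpha_neg (D : SquareRoots q n) {k : ℕ} (hk : 0 < k) :
    alpha D (-(k : ℤ)) = -alpha D k := by
  obtain ⟨m, rfl⟩ := Nat.exists_eq_succ_of_ne_zero hk.ne'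
  rfl

theorem alpha0_mul_nat (D : SquareRoots q n) {k : ℕ} (hk : 0 < k) (hkn : k < n) :
    alpha0 D k * alpha0 D (-(k : ℤ)) =
      1 - (1 + ((q : F) - (q : F)⁻¹) * qInt q k) / qInt q k ^ 2 := by
  have hq : (q : F) ≠ 0 := q.ne_zero
  have hX := D.qInt_ne_zero k (by omega) (by omega)
  by_cases h1 : k = 1
  · subst h1
    have : qInt q ((1 : ℕ) : ℤ) = q := by
      change qInt q (Int.ofNat 1) = _
      simp [qInt]
    rw [this, alpha0, if_pos (by simp)]
    field_simp
    ring
  · rw [alpha0, alpha0, if_neg (by omega), if_neg (by omega), alpha_neg D hk]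
    have e : alpha D (k : ℤ) = D.sqrtNegOne * D.sqrtQ (k + 1) * D.sqrtQ (k - 1) / qInt q k := rfl
    have s1 := D.sqrtQ_sq (k + 1) (by omega) (by omega)
    have s2 := D.sqrtQ_sq (k - 1) (by omega) (by omega)
    have s0 := D.sqrtNegOne_sq
    have a1 := qInt_succ q (k : ℤ)
    have a2 := qInt_succ q ((k : ℤ) - 1)
    have m := qInt_mul q (k : ℤ)
    rw [show 2 * ((k : ℤ) - 1) + 1 = 2 * k + (-1) by ring, zpow_add, sub_add_cancel] at a2
    rw [zpow_add] at a1
    push_cast [Nat.cast_sub (show 1 ≤ k by omega)] at s1 s2 a1 a2 m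
    rw [← m, zpow_one] at a1
    rw [← m, zpow_neg_one] at a2
    rw [a1] at s1
    have s2' : D.sqrtQ (k - 1) ^ 2 = qInt q (k : ℤ) -
        (1 + ((q : F) - (q : F)⁻¹) * qInt q k) * (q : F)⁻¹ := by
      rw [s2]; linear_combination -a2
    rw [e]
    generalize qInt q (k : ℤ) = X at *
    rw [show D.sqrtNegOne * D.sqrtQ (k + 1) * D.sqrtQ (k - 1) / X *
        -(D.sqrtNegOne * D.sqrtQ (k + 1) * D.sqrtQ (k - 1) / X) =
        -(D.sqrtNegOne ^ 2 * D.sqrtQ (k + 1) ^ 2 * D.sqrtQ (k - 1) ^ 2 / X ^ 2) by ring,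
      s0, s1, s2']
    field_simp
    ring

theorem alpha0_mul (D : SquareRoots q n) {k : ℤ} (hk : k ≠ 0) (h1 : k < n) (h2 : -k < n) :
    alpha0 D k * alpha0 D (-k) =
      1 - (1 + ((q : F) - (q : F)⁻¹) * qInt q k) / qInt q k ^ 2 := by
  rcases lt_or_gt_of_ne hk with h | h
  · obtain ⟨m, hm⟩ := Int.eq_ofNat_of_zero_le (show 0 ≤ -k by omega)
    obtain rfl : k = -(m : ℤ) := by omega
    have e := alpha0_mul_nat D (k := m) (by omega) (by omega)
    have hX := D.qInt_ne_zero m (by omega) (by omega)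
    have hu : 1 + ((q : F) - (q : F)⁻¹) * qInt q m ≠ 0 := by
      rw [qInt_mul]; exact Units.ne_zero _
    rw [neg_neg, mul_comm, e, qInt_neg]
    generalize qInt q (m : ℤ) = X at *
    generalize (q : F) - (q : F)⁻¹ = d at *
    field_simp
    ring
  · obtain ⟨m, rfl⟩ := Int.eq_ofNat_of_zero_le h.le
    exact alpha0_mul_nat D (by omega) (by omega)

variable {μ : YoungDiagram}

open Classical in
/-- The basis vector `v_t`, extended by zero to all bijective tableaux. -/
def vec (F : Type*) [Field F] (t : μ.cells ≃ Fin n) : SpechtSpace F μ n :=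
  if h : IsStandard t then Finsupp.single (⟨t, h⟩ : Std μ n) 1 else 0

theorem spechtOp_vec (D : SquareRoots q n) (i : Fin (n - 1)) (t : μ.cells ≃ Fin n) :
    spechtOp D μ i (vec F t) =
      (-1 / qInt q (axial t i)) • vec F t + alpha0 D (axial t i) • vec F (act t i) := by
  by_cases ht : IsStandard t
  · rw [vec, dif_pos ht, spechtOp, Finsupp.linearCombination_single, one_smul]
    by_cases h : IsStandard (act t i)
    · have h' := (isStandard_act_iff ht i).1 h
      rw [dif_pos h, vec, dif_pos h, alpha0, if_neg (by tauto)]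
    · have h' := mt (isStandard_act_iff ht i).2 h
      rw [dif_neg h, vec, dif_neg h, smul_zero]
  · have hv : vec F t = 0 := by rw [vec, dif_neg ht]
    rw [hv, map_zero, smul_zero, zero_add]
    by_cases h : IsStandard (act t i)
    · have h' := mt (isStandard_act_iff h i).2 (by rwa [act_act])
      rw [axial_act] at h'
      rw [alpha0, if_pos (by omega), zero_smul]
    · rw [vec, dif_neg h, smul_zero]

theorem end_ext {f g : Module.End F (SpechtSpace F μ n)}
    (h : ∀ t : μ.cells ≃ Fin n, IsStandard t → f (vec F t) = g (vec F t)) : f = g := by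
  apply Finsupp.lhom_ext'
  rintro ⟨t, ht⟩
  apply LinearMap.ext_ring
  have := h t ht
  rw [vec, dif_pos ht] at this
  exact this

theorem spechtOp_quadratic (D : SquareRoots q n) (i : Fin (n - 1)) :
    spechtOp D μ i * spechtOp D μ i =
      ((q : F) - (q : F)⁻¹) • spechtOp D μ i + 1 := by
  apply end_ext
  intro t ht
  have h0 := axial_ne_zero ht i
  have h1 : axial t i < n := content_sub_lt t _ _
  have h2 : -axial t i < n := by rw [axial, neg_sub]; exact content_sub_lt t _ _
  have hX := D.qInt_ne h0 h1 h2
  have hα := alpha0_mul D h0 h1 h2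
  have hu : 1 + ((q : F) - (q : F)⁻¹) * qInt q (axial t i) ≠ 0 := by
    rw [qInt_mul]; exact Units.ne_zero _
  simp only [Module.End.mul_apply, LinearMap.add_apply, LinearMap.smul_apply, Module.End.one_apply,
    spechtOp_vec, map_add, map_smul, act_act, axial_act, qInt_neg]
  generalize vec F t = v
  generalize vec F (act t i) = w
  generalize qInt q (axial t i) = X at *
  generalize alpha0 D (axial t i) = a at *
  generalize alpha0 D (-axial t i) = b at *
  generalize (q : F) - (q : F)⁻¹ = d at *
  have e1 : (-1 / X) * (-1 / X) + a * b = d * (-1 / X) + 1 := by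
    rw [hα]; field_simp; ring
  have e2 : (-1 / X) * a + a * (-1 / (-X / (1 + d * X))) = d * a := by
    field_simp; ring
  linear_combination (norm := module) e1 • v + e2 • w

theorem s_comm {i j : Fin (n - 1)} (h : i.1 + 1 < j.1) (k : Fin n) :
    s i (s j k) = s j (s i k) := by
  apply Fin.ext
  rw [s_apply_val, s_apply_val, s_apply_val, s_apply_val]
  generalize i.1 = i' at *
  generalize j.1 = j' at *
  generalize k.1 = k'
  rcases lt_trichotomy k' i' with h1 | rfl | h1
  · simp [show k' ≠ i' by omega, show k' ≠ i' + 1 by omega, show k' ≠ j' by omega,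
      show k' ≠ j' + 1 by omega]
  · grind
  · grind

theorem s_braid {i j : Fin (n - 1)} (h : i.1 + 1 = j.1) (k : Fin n) :
    s i (s j (s i k)) = s j (s i (s j k)) := by
  apply Fin.ext
  simp only [s_apply_val, ← h]
  generalize i.1 = i'
  generalize k.1 = k'
  grind

theorem spechtOp_commute (D : SquareRoots q n) (i j : Fin (n - 1)) (h : i.1 + 1 < j.1) :
    spechtOp D μ i * spechtOp D μ j = spechtOp D μ j * spechtOp D μ i := by
  apply end_ext
  intro t _
  have e1 : act (act t i) j = act (act t j) i := by
    ext x; simp only [act_apply, s_comm h]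
  have f : ∀ (i j : Fin (n - 1)), (i.1 + 1 < j.1 ∨ j.1 + 1 < i.1) →
      axial (act t i) j = axial t j := by
    intro i j h
    have a1 : s i (lo j) = lo j := by ext; simp only [s_apply_val, lo]; split_ifs <;> omega
    have a2 : s i (hi j) = hi j := by ext; simp only [s_apply_val, hi]; split_ifs <;> omega
    rw [axial, content_act, content_act, a1, a2, axial]
  simp only [Module.End.mul_apply, spechtOp_vec, map_add, map_smul, e1, f i j (Or.inl h),
    f j i (Or.inr h)]
  module

theorem spechtOp_braid (D : SquareRoots q n) (i j : Fin (n - 1)) (h : i.1 + 1 = j.1) :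
    spechtOp D μ i * spechtOp D μ j * spechtOp D μ i =
      spechtOp D μ j * spechtOp D μ i * spechtOp D μ j := by
  apply end_ext
  intro t ht
  have e1 : act (act (act t i) j) i = act (act (act t j) i) j := by
    ext x; simp only [act_apply, s_braid h]
  have hij : lo j = hi i := Fin.ext h.symm
  have b1 : s i (lo i) = hi i := Equiv.swap_apply_left _ _
  have b2 : s i (hi i) = lo i := Equiv.swap_apply_right _ _
  have b3 : s i (hi j) = hi j := by ext; simp only [s_apply_val, hi]; split_ifs <;> omega
  have b4 : s j (lo i) = lo i := by ext; simp only [s_apply_val, lo]; split_ifs <;> omega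
  have b5 : s j (hi i) = hi j := by rw [← hij]; exact Equiv.swap_apply_left _ _
  have b6 : s j (hi j) = hi i := by rw [← hij]; exact Equiv.swap_apply_right _ _
  have hx0 : content t (lo i) - content t (hi i) ≠ 0 := axial_ne_zero ht i
  have hy0 : content t (hi i) - content t (hi j) ≠ 0 := by
    have := axial_ne_zero ht j
    rwa [axial, hij] at this
  have hz0 : content t (lo i) - content t (hi j) ≠ 0 :=
    sub_ne_zero.2 (ht.content_ne (by simp [lo, hi]; omega) (by simp [lo, hi]; omega))
  have c1 := content_sub_lt t (lo i) (hi i)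
  have c2 := content_sub_lt t (hi i) (lo i)
  have c3 := content_sub_lt t (hi i) (hi j)
  have c4 := content_sub_lt t (hi j) (hi i)
  have c5 := content_sub_lt t (lo i) (hi j)
  have c6 := content_sub_lt t (hi j) (lo i)
  have hX := D.qInt_ne hx0 c1 (by omega)
  have hY := D.qInt_ne hy0 c3 (by omega)
  have hZ := D.qInt_ne hz0 c5 (by omega)
  have hα := alpha0_mul D hx0 c1 (by omega)
  have hβ := alpha0_mul D hy0 c3 (by omega)
  have hzz := qInt_add q (content t (lo i) - content t (hi i)) (content t (hi i) - content t (hi j))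
  rw [← qInt_mul, sub_add_sub_cancel] at hzz
  have hux : 1 + ((q : F) - (q : F)⁻¹) * qInt q (content t (lo i) - content t (hi i)) ≠ 0 := by
    rw [qInt_mul]; exact Units.ne_zero _
  have huy : 1 + ((q : F) - (q : F)⁻¹) * qInt q (content t (hi i) - content t (hi j)) ≠ 0 := by
    rw [qInt_mul]; exact Units.ne_zero _
  have nx := qInt_neg q (content t (lo i) - content t (hi i))
  have ny := qInt_neg q (content t (hi i) - content t (hi j))
  rw [neg_sub] at nx ny hα hβ
  simp only [Module.End.mul_apply, spechtOp_vec, map_add, map_smul, act_act, e1, axial,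
    content_act, hij, b1, b2, b3, b4, b5, b6]
  rw [nx, ny]
  generalize vec F t = v0
  generalize vec F (act t i) = v1
  generalize vec F (act t j) = v2
  generalize vec F (act (act t i) j) = v3
  generalize vec F (act (act t j) i) = v4
  generalize vec F (act (act (act t j) i) j) = v5
  generalize qInt q (content t (lo i) - content t (hi i)) = X at *
  generalize qInt q (content t (hi i) - content t (hi j)) = Y at *
  generalize qInt q (content t (lo i) - content t (hi j)) = Z at *
  generalize alpha0 D (content t (lo i) - content t (hi i)) = a at *
  generalize alpha0 D (content t (hi i) - content t (lo i)) = a' at *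
  generalize alpha0 D (content t (hi i) - content t (hi j)) = b at *
  generalize alpha0 D (content t (hi j) - content t (hi i)) = b' at *
  generalize alpha0 D (content t (lo i) - content t (hi j)) = c at *
  generalize (q : F) - (q : F)⁻¹ = d at *
  have k0 : (-1 / X) * (-1 / Y) * (-1 / X) + a * a' * (-1 / Z) =
      (-1 / Y) * (-1 / X) * (-1 / Y) + b * b' * (-1 / Z) := by
    rw [hα, hβ]; field_simp; rw [hzz]; ring
  have k1 : (-1 / X) * (-1 / Y) * a + a * (-1 / Z) * (-1 / (-X / (1 + d * X))) =
      (-1 / Y) * a * (-1 / Z) := by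
    field_simp; rw [hzz]; ring
  have k2 : (-1 / Y) * (-1 / X) * b + b * (-1 / Z) * (-1 / (-Y / (1 + d * Y))) =
      (-1 / X) * b * (-1 / Z) := by
    field_simp; rw [hzz]; ring
  linear_combination (norm := module) k0 • v0 + k1 • v1 - k2 • v2

/-- The Specht module `S(μ)`: the right module of the Hecke algebra on which the generator `T_i`
acts by `spechtOp D μ i`. -/
def specht (D : SquareRoots q n) (μ : YoungDiagram) :
    Hecke q n →ₐ[F] (Module.End F (SpechtSpace F μ n))ᵐᵒᵖ :=
  lift q (fun i ↦ MulOpposite.op (spechtOp D μ i))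
    (by
      intro i
      have h := spechtOp_quadratic (μ := μ) D i
      have hq : (q : F) ≠ 0 := q.ne_zero
      apply MulOpposite.unop_injective
      apply LinearMap.ext
      intro v
      have hv := congrArg (fun f ↦ f v) h
      simp only [Module.End.mul_apply, LinearMap.add_apply, LinearMap.smul_apply,
        Module.End.one_apply] at hv
      simp only [MulOpposite.unop_mul, MulOpposite.unop_sub, MulOpposite.unop_add,
        MulOpposite.unop_op, MulOpposite.algebraMap_apply, Module.End.mul_apply,
        LinearMap.add_apply, LinearMap.sub_apply, Module.algebraMap_end_apply, map_sub, map_smul,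
        hv, MulOpposite.unop_zero, LinearMap.zero_apply, Units.val_inv_eq_inv_val]
      have e : (1 - (q : F) * (q : F)⁻¹) = 0 := by rw [mul_inv_cancel₀ hq, sub_self]
      linear_combination (norm := module) e • v)
    (by
      intro i j h
      rw [← MulOpposite.op_mul, ← MulOpposite.op_mul, spechtOp_commute D i j h])
    (by
      intro i j h
      simp only [← MulOpposite.op_mul, ← mul_assoc]
      rw [spechtOp_braid D i j h])

theorem specht_gen (D : SquareRoots q n) (μ : YoungDiagram) (i : Fin (n - 1)) :
    specht D μ (gen q i) = MulOpposite.op (spechtOp D μ i) :=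
  lift_gen q _ _ _ _ i

/-- The character `χ^μ` of the Specht module `S(μ)`. -/
def chi (D : SquareRoots q n) (μ : YoungDiagram) : Hecke q n → F :=
  character (specht D μ)

/-- The character of the restriction of `S(μ)` to the alternating Hecke algebra. -/
def chiAlt (D : SquareRoots q n) (μ : YoungDiagram) : Alt q n → F :=
  character (res (Alt q n) (specht D μ))

end Specht

end AltHecke

end

/-!
The reflection `t ↦ t'` of tableaux in the diagonal negates contents, hence the axial distance `ρ`
from `i` to `i + 1`. Since `-1/[-ρ] = q - q⁻¹ - (-1/[ρ])` and `α_{-ρ} = -α_ρ`, the map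
`v_t ↦ v_{t'}` carries the action of `T_i^# = q - q⁻¹ - T_i` on `S(μ)` to the action of `T_i` on
`S(μ')`. Thus `S(μ')` is `S(μ)` twisted by `#`, so `χ^μ(x^#) = χ^{μ'}(x)` for every `x`; the theorem
is the case `x = T_w` together with the linearity of `χ^μ`.
-/

noncomputable section

namespace AltHecke

section Character

variable {F B V W : Type*} [Field F] [Ring B] [Algebra F B] [AddCommGroup V] [Module F V]
  [AddCommGroup W] [Module F W]

theorem character_add (M : B →ₐ[F] (Module.End F V)ᵐᵒᵖ) (a b : B) :
    character M (a + b) = character M a + character M b := by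
  simp only [character, map_add, MulOpposite.unop_add]

theorem character_smul (M : B →ₐ[F] (Module.End F V)ᵐᵒᵖ) (c : F) (b : B) :
    character M (c • b) = c * character M b := by
  simp only [character, map_smul, MulOpposite.unop_smul, smul_eq_mul]

theorem character_eq_of_conj {M : B →ₐ[F] (Module.End F V)ᵐᵒᵖ} {N : B →ₐ[F] (Module.End F W)ᵐᵒᵖ}
    (e : V ≃ₗ[F] W) {b : B} (h : e.conj (M b).unop = (N b).unop) :
    character M b = character N b := by
  rw [character, character, ← h, LinearMap.trace_conj']

end Character

section HeckeModule

variable {R V W : Type*} [CommRing R] [AddCommGroup V] [Module R V] [AddCommGroup W] [Module R W]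
  {q : Rˣ} {n : ℕ}

theorem conj_unop_eq_of_gen {M : Hecke q n →ₐ[R] (Module.End R V)ᵐᵒᵖ}
    {N : Hecke q n →ₐ[R] (Module.End R W)ᵐᵒᵖ} (e : V ≃ₗ[R] W)
    (h : ∀ i, e.conj (M (gen q i)).unop = (N (gen q i)).unop) (x : Hecke q n) :
    e.conj (M x).unop = (N x).unop := by
  have hMN : (AlgEquiv.op (e.conjAlgEquiv R)).toAlgHom.comp M = N :=
    algHom_ext_gen q fun i ↦ MulOpposite.unop_injective (h i)
  rw [← hMN]
  rfl

end HeckeModule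

section ConjugateTableau

variable {μ : YoungDiagram} {n : ℕ}

/-- Reflection in the diagonal, as a bijection from the cells of `μ` to those of the conjugate
diagram. -/
def conjCells (μ : YoungDiagram) : μ.cells ≃ μ.transpose.cells :=
  (Equiv.prodComm ℕ ℕ).subtypeEquiv fun x ↦ by
    simp only [YoungDiagram.mem_cells, YoungDiagram.mem_transpose, Equiv.prodComm_apply,
      Prod.swap_swap]

/-- The conjugate `t'` of a bijective tableau `t`, with the entry of `t` at `(r, c)` placed at
`(c, r)`. -/
def conjTab : (μ.cells ≃ Fin n) ≃ (μ.transpose.cells ≃ Fin n) :=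
  (conjCells μ).equivCongr (Equiv.refl _)

theorem content_conjTab (t : μ.cells ≃ Fin n) (k : Fin n) :
    content (conjTab t) k = -content t k :=
  (neg_sub _ _).symm

theorem axial_conjTab (t : μ.cells ≃ Fin n) (i : Fin (n - 1)) :
    axial (conjTab t) i = -axial t i := by
  simp only [axial, content_conjTab]
  ring

theorem act_conjTab (t : μ.cells ≃ Fin n) (i : Fin (n - 1)) :
    act (conjTab t) i = conjTab (act t i) := rfl

theorem isStandard_conjTab_iff (t : μ.cells ≃ Fin n) :
    IsStandard (conjTab t) ↔ IsStandard t where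
  mp h x y hxy hr hc := h (conjCells μ x) (conjCells μ y) ((conjCells μ).injective.ne hxy) hc hr
  mpr h x y hxy hr hc := h ((conjCells μ).symm x) ((conjCells μ).symm y)
    ((conjCells μ).symm.injective.ne hxy) hc hr

/-- Conjugation of standard tableaux, as a bijection between those of shape `μ` and those of the
conjugate shape. -/
def conjStd (μ : YoungDiagram) (n : ℕ) : Std μ n ≃ Std μ.transpose n where
  toFun t := ⟨conjTab t.tab, (isStandard_conjTab_iff _).2 t.isStandard⟩
  invFun t := ⟨conjTab.symm t.tab, (isStandard_conjTab_iff _).1 <| by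
    rw [Equiv.apply_symm_apply]; exact t.isStandard⟩
  left_inv t := by simp only [Equiv.symm_apply_apply]
  right_inv t := by simp only [Equiv.apply_symm_apply]

end ConjugateTableau

section ConjugateSpecht

variable {F : Type*} [Field F] {q : Fˣ} {μ : YoungDiagram} {n : ℕ}

theorem neg_one_div_qInt_neg (q : Fˣ) {k : ℤ} (hk : qInt q k ≠ 0) :
    -1 / qInt q (-k) = ((q : F) - (q : F)⁻¹) - -1 / qInt q k := by
  rw [qInt_neg, div_div_eq_mul_div, neg_one_mul, neg_div_neg_eq, add_div,
    mul_div_cancel_right₀ _ hk, neg_div, sub_neg_eq_add, add_comm]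

theorem IsStandard.qInt_axial_ne_zero (D : SquareRoots q n) {t : μ.cells ≃ Fin n}
    (ht : IsStandard t) (i : Fin (n - 1)) : qInt q (axial t i) ≠ 0 := by
  have neg_axial_lt : -axial t i < n := by
    rw [axial, neg_sub]
    exact content_sub_lt t _ _
  exact D.qInt_ne (axial_ne_zero ht i) (content_sub_lt t _ _) neg_axial_lt

theorem alpha_neg_of_ne_zero (D : SquareRoots q n) {k : ℤ} (hk : k ≠ 0) :
    alpha D (-k) = -alpha D k := by
  obtain ⟨m, rfl | rfl⟩ := k.eq_nat_or_neg
  · exact alpha_neg D (by omega)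
  · rw [alpha_neg D (by omega), neg_neg, neg_neg]

theorem alpha0_neg (D : SquareRoots q n) {k : ℤ} (hk : k ≠ 0) : alpha0 D (-k) = -alpha0 D k := by
  by_cases h : k = 1 ∨ k = -1
  · rw [alpha0, alpha0, if_pos h, if_pos (by omega), neg_zero]
  · rw [alpha0, alpha0, if_neg h, if_neg (by omega), alpha_neg_of_ne_zero D hk]

/-- The linear isomorphism `v_t ↦ v_{t'}` between the Specht modules of conjugate shapes. -/
def conjSpecht (F : Type*) [Field F] (μ : YoungDiagram) (n : ℕ) :
    SpechtSpace F μ n ≃ₗ[F] SpechtSpace F μ.transpose n :=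
  Finsupp.domLCongr (conjStd μ n)

theorem conjSpecht_vec (t : μ.cells ≃ Fin n) :
    conjSpecht F μ n (vec F t) = vec F (conjTab t) := by
  by_cases h : IsStandard t
  · rw [vec, dif_pos h, vec, dif_pos ((isStandard_conjTab_iff t).2 h), conjSpecht,
      Finsupp.domLCongr_single]
    rfl
  · rw [vec, dif_neg h, vec, dif_neg (mt (isStandard_conjTab_iff t).1 h), map_zero]

theorem spechtOp_vec_conjTab (D : SquareRoots q n) {t : μ.cells ≃ Fin n} (ht : IsStandard t)
    (i : Fin (n - 1)) :
    spechtOp D μ.transpose i (vec F (conjTab t)) =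
      conjSpecht F μ n (((q : F) - (q : F)⁻¹) • vec F t - spechtOp D μ i (vec F t)) := by
  simp only [spechtOp_vec, map_sub, map_add, map_smul, conjSpecht_vec, axial_conjTab, act_conjTab,
    neg_one_div_qInt_neg q (ht.qInt_axial_ne_zero D i), alpha0_neg D (axial_ne_zero ht i)]
  module

theorem unop_specht_hash_gen (D : SquareRoots q n) (μ : YoungDiagram) (i : Fin (n - 1)) :
    (specht D μ (hash q (gen q i))).unop = ((q : F) - (q : F)⁻¹) • 1 - spechtOp D μ i := by
  rw [hash_gen, hashGen, map_sub, map_smul, map_one, specht_gen, Units.val_inv_eq_inv_val]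
  rfl

theorem conj_specht_hash_gen (D : SquareRoots q n) (μ : YoungDiagram) (i : Fin (n - 1)) :
    (conjSpecht F μ n).conj (specht D μ (hash q (gen q i))).unop =
      (specht D μ.transpose (gen q i)).unop := by
  rw [unop_specht_hash_gen, specht_gen, MulOpposite.unop_op]
  refine end_ext fun t' ht' ↦ ?_
  obtain ⟨t, rfl⟩ := conjTab.surjective t'
  rw [spechtOp_vec_conjTab D ((isStandard_conjTab_iff t).1 ht'), LinearEquiv.conj_apply_apply,
    ← conjSpecht_vec, LinearEquiv.symm_apply_apply]
  rfl

theorem chi_hash (D : SquareRoots q n) (μ : YoungDiagram) (x : Hecke q n) :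
    chi D μ (hash q x) = chi D μ.transpose x :=
  character_eq_of_conj (M := (specht D μ).comp (hash q).toAlgHom) (conjSpecht F μ n)
    (conj_unop_eq_of_gen _ (conj_specht_hash_gen D μ) x)

theorem chiAlt_altA (D : SquareRoots q n) (μ : YoungDiagram) (w : alternatingGroup (Fin n)) :
    chiAlt D μ (altA q w) = chi D μ (A q w.1) := rfl

end ConjugateSpecht

end AltHecke

end

theorem mainTheorem8_general {F : Type*} [Field F] (h2 : (2 : F) ≠ 0) (q : Fˣ) (n : ℕ)
    (D : AltHecke.SquareRoots q n) (μ : YoungDiagram) (w : Equiv.Perm (Fin n)) :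
    2 * AltHecke.chi D μ (AltHecke.A q w) =
      AltHecke.chi D μ (AltHecke.T q w) +
        (-1) ^ AltHecke.length w * AltHecke.chi D μ.transpose (AltHecke.T q w) := by
  rw [← AltHecke.chi_hash, AltHecke.A, AltHecke.chi, AltHecke.character_smul,
    AltHecke.character_add, AltHecke.character_smul, mul_inv_cancel_left₀ h2]

theorem mainTheorem8 {F : Type*} [Field F] (h2 : (2 : F) ≠ 0) (q : Fˣ) (n : ℕ) (hn : 1 ≤ n)
    (D : AltHecke.SquareRoots q n) (μ : YoungDiagram) (hμ : μ.card = n)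
    (w : alternatingGroup (Fin n)) :
    AltHecke.chiAlt D μ (AltHecke.altA q w) =
      (2 : F)⁻¹ * (AltHecke.chi D μ (AltHecke.T q w.1) +
        AltHecke.chi D μ.transpose (AltHecke.T q w.1)) := by
  rw [AltHecke.chiAlt_altA, eq_inv_mul_iff_mul_eq₀ h2, mainTheorem8_general h2,
    (AltHecke.even_length w.2).neg_one_pow, one_mul]
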